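/- Theorem (Upper and lower bound of $X^{T}H^{ZZ_\pi}X$). For a real matrix $M$ with $n$ rows let $H^{M}\in\mathbb{R}^{n\times n}$ be the orthogonal projection of $\mathbb{R}^n$ onto the column space of $M$. For a permutation $\pi$ of $\{1,\dots,n\}$ let $P_\pi$ be its permutation matrix, $Z_\pi=P_\pi Z$, and let $ZZ_\pi=[Z,Z_\pi]$ be the horizontal concatenation. (Lower bound.) For every real $n\times(p-1)$ matrix $Z$, every permutation $\pi$ of $\{1,\dots,n\}$ and every $X\in\mathbb{R}^n$, $$X^{T}H^{ZZ_\pi}X\ \ge\ \|H^{Z}X\|_2^2+\|H^{Z_\pi}(X-H^{Z}X)\|_2^2 .$$ (Upper bound.) For all $c_1,c_2>0$ there is a constant $C>0$, depending only on $c_1,c_2$, with the following property. Let $n,p\ge 1$, and let $Z$ be a random $n\times(p-1)$ real matrix whose rows $z_1,\dots,z_n$ are independent (not necessarily identically distributed), have mean zero, and satisfy, for every $r$ and every $v\in\mathbb{R}^{p-1}$ with $\|v\|_2=1$, $$\mathbb{E}\big[(z_r^{T}v)^2\big]\ge c_1,\qquad \mathbb{E}\big[e^{t z_r^{T}v}\big]\le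 e^{c_2t^2}\quad\text{for all } t\in\mathbb{R}.$$ Then for every (fixed) permutation $\pi$ of $\{1,\dots,n\}$ with $C\,(p+\operatorname{tr}P_\pi)<n$, with probability at least $1-40e^{-p}$ over the distribution of $Z$, simultaneously for all $X\in\mathbb{R}^n$, $$\|H^{ZZ_\pi}X\|_2^2\ \le\ \|H^{Z}X\|_2^2+\frac{1}{1-\frac{C(p+\operatorname{tr}P_\pi)}{n}}\,\|H^{Z_\pi}(X-H^{Z}X)\|_2^2 .$$ -/

import Mathlib

open MeasureTheory ProbabilityTheory

/-- The column space of a real matrix `M` with `n` rows, as a subspace of Euclidean `ℝⁿ`. -/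
def colSpace {n : ℕ} {ι : Type*} (M : Matrix (Fin n) ι ℝ) :
    Submodule ℝ (EuclideanSpace ℝ (Fin n)) :=
  Submodule.span ℝ (Set.range fun j : ι => WithLp.toLp 2 (fun i => M i j))

/-- The hat operator `H^M`: the orthogonal projection of Euclidean `ℝⁿ` onto the column space
of `M`. No rank condition on `M` is needed. -/
noncomputable def hat {n : ℕ} {ι : Type*} (M : Matrix (Fin n) ι ℝ) :
    EuclideanSpace ℝ (Fin n) →L[ℝ] EuclideanSpace ℝ (Fin n) :=
  (colSpace M).starProjection

/-- The row-permuted matrix `M_π = P_π M`, whose `i`-th row is row `π i` of `M`. -/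
def permRows {n : ℕ} {ι : Type*} (π : Equiv.Perm (Fin n)) (M : Matrix (Fin n) ι ℝ) :
    Matrix (Fin n) ι ℝ :=
  π.permMatrix ℝ * M

/-- The horizontal concatenation `Z Z_π = [Z, P_π Z]`. -/
def joint {n : ℕ} {ι : Type*} (π : Equiv.Perm (Fin n)) (Z : Matrix (Fin n) ι ℝ) :
    Matrix (Fin n) (ι ⊕ ι) ℝ :=
  Matrix.fromCols Z (permRows π Z)

/-! Let `U`, `V` be the column spaces of `Z` and `P_π Z`, and let `r = X - H^Z X`, which is
orthogonal to `U`. By Pythagoras the squared projection of `X` onto `U ⊔ V` is `‖H^Z X‖²` plus the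
squared projection of `r` onto `U ⊔ V`. The lower bound follows because projecting `r` onto the
smaller space `V` can only shorten it. For the upper bound, if the squared cosine of the angle
between `U` and `V` is at most `ε`, the projection of `r` onto `U ⊔ V` exceeds the one onto `V` by
at most `1 / (1 - ε)` in squared norm (`norm_sq_starProjection_sup_le`).

It remains to bound this cosine by `ε = C (p + k) / n`, where `k = tr P_π` counts the fixed points.
Its denominator needs `‖Z a‖² ≥ c₁ n ‖a‖² / 2` (`exists_event_lower_isometry`), its numerator `|⟨Z
a, P_π Z b⟩| ≲ √((p + k) n) ‖a‖ ‖b‖` (`exists_event_permuted_bilin_le`). Both come from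
`exists_event_bilin_concentration`: Bernstein's inequality for each pair `(a, b)` in a net of the
sphere, then a union bound. Bernstein needs independent summands, but `⟨zᵢ, a⟩ ⟨z_{π i}, b⟩` shares
rows with its neighbours along a cycle of `π`. Fixed points are therefore treated apart, and a
three-colouring splits the other indices into classes whose blocks `{i, π i}` are disjoint. -/

/-! ### Sub-Gaussian moments and Bernstein's inequality. -/

/-- The exponential of the square of a standard Gaussian, divided by four, has mean at most `2`. -/
lemma lintegral_exp_sq_div_four_gaussianReal_le :
    ∫⁻ g, ENNReal.ofReal (Real.exp (g ^ 2 / 4)) ∂(gaussianReal 0 1) ≤ 2 := by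
  rw [gaussianReal_of_var_ne_zero _ one_ne_zero,
    lintegral_withDensity_eq_lintegral_mul _ (measurable_gaussianPDF 0 1) (by fun_prop)]
  have h : ∀ g : ℝ, (gaussianPDF 0 1 * fun g => ENNReal.ofReal (Real.exp (g ^ 2 / 4))) g
      = ENNReal.ofReal ((√(2 * Real.pi))⁻¹ * Real.exp (-(1 / 4) * g ^ 2)) := by
    intro g
    simp only [Pi.mul_apply, gaussianPDF, gaussianPDFReal]
    rw [← ENNReal.ofReal_mul (by positivity), mul_assoc, ← Real.exp_add]
    simp only [NNReal.coe_one, mul_one, sub_zero]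
    congr 3
    ring
  simp_rw [h]
  rw [← ofReal_integral_eq_lintegral_ofReal
    ((integrable_exp_neg_mul_sq (by norm_num)).const_mul _)
    (Filter.Eventually.of_forall fun g => by positivity), integral_const_mul, integral_gaussian]
  rw [show (2 : ENNReal) = ENNReal.ofReal 2 by simp]
  apply ENNReal.ofReal_le_ofReal
  rw [inv_mul_le_iff₀ (by positivity), Real.sqrt_le_left (by positivity), mul_pow,
    Real.sq_sqrt (by positivity)]
  nlinarith [Real.pi_pos]

section

variable {Ω : Type*} [MeasurableSpace Ω] {μ : Measure Ω}

/-- A real random variable with sub-Gaussian moment generating function has a finite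
exponential square moment. -/
lemma exp_sq_moment_of_subgaussian [IsProbabilityMeasure μ] {x : Ω → ℝ} (hx : Measurable x)
    {c : ℝ} (hc : 0 < c)
    (h : ∀ t : ℝ, Integrable (fun ω => Real.exp (t * x ω)) μ ∧
      ∫ ω, Real.exp (t * x ω) ∂μ ≤ Real.exp (c * t ^ 2)) :
    Integrable (fun ω => Real.exp (x ω ^ 2 / (8 * c))) μ ∧
      ∫ ω, Real.exp (x ω ^ 2 / (8 * c)) ∂μ ≤ 2 := by
  -- Gaussian linearisation: `exp (x² / (8c))` is the mean of `exp (b x g)` over a standard Gaussian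
  -- `g`, since `b² / 2 = 1 / (8c)`. After swapping the integrals, the hypothesis at `t = b g` gives
  -- `exp (c b² g²) = exp (g² / 4)`.
  set b : ℝ := (√(4 * c))⁻¹ with hb
  have hb2 : b ^ 2 = 1 / (4 * c) := by
    rw [hb, inv_pow, Real.sq_sqrt (by positivity), one_div]
  have key : ∫⁻ ω, ENNReal.ofReal (Real.exp (x ω ^ 2 / (8 * c))) ∂μ ≤ 2 := by
    have h1 : ∀ ω, ENNReal.ofReal (Real.exp (x ω ^ 2 / (8 * c)))
        = ∫⁻ g, ENNReal.ofReal (Real.exp (b * x ω * g)) ∂(gaussianReal 0 1) := by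
      intro ω
      rw [← ofReal_integral_eq_lintegral_ofReal (integrable_exp_mul_gaussianReal _)
        (Filter.Eventually.of_forall fun g => by positivity)]
      have := mgf_gaussianReal (p := gaussianReal 0 1) (X := id) (μ := 0) (v := 1)
        (by simp) (b * x ω)
      simp only [mgf, id] at this
      rw [this, mul_pow, hb2]
      congr 2
      simp only [NNReal.coe_one]
      field_simp
      ring
    simp_rw [h1]
    rw [lintegral_lintegral_swap (by fun_prop)]
    refine le_trans (lintegral_mono fun g => ?_) lintegral_exp_sq_div_four_gaussianReal_le
    have h2 := h (b * g)
    have h3 : ∀ ω, b * x ω * g = b * g * x ω := fun ω => by ring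
    simp_rw [h3]
    rw [← ofReal_integral_eq_lintegral_ofReal h2.1
      (Filter.Eventually.of_forall fun g => by positivity)]
    apply ENNReal.ofReal_le_ofReal
    refine h2.2.trans (le_of_eq ?_)
    rw [mul_pow, hb2]
    congr 1
    field_simp
  have hint : Integrable (fun ω => Real.exp (x ω ^ 2 / (8 * c))) μ := by
    refine ⟨by fun_prop, ?_⟩
    rw [hasFiniteIntegral_iff_ofReal (Filter.Eventually.of_forall fun g => by positivity)]
    exact key.trans_lt (by simp)
  refine ⟨hint, ?_⟩
  rw [← ofReal_integral_eq_lintegral_ofReal hint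
    (Filter.Eventually.of_forall fun g => by positivity)] at key
  rw [show (2 : ENNReal) = ENNReal.ofReal 2 by simp] at key
  exact (ENNReal.ofReal_le_ofReal_iff (by norm_num)).1 key

/-- Products of variables with exponential square moments have exponential moments. -/
lemma exp_abs_mul_moment {x y : Ω → ℝ} (hx : Measurable x) (hy : Measurable y) {τ A : ℝ}
    (hτ : 0 < τ) (hxi : Integrable (fun ω => Real.exp (τ * x ω ^ 2)) μ)
    (hyi : Integrable (fun ω => Real.exp (τ * y ω ^ 2)) μ)
    (hxA : ∫ ω, Real.exp (τ * x ω ^ 2) ∂μ ≤ A) (hyA : ∫ ω, Real.exp (τ * y ω ^ 2) ∂μ ≤ A) :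
    Integrable (fun ω => Real.exp (τ * |x ω * y ω|)) μ ∧
      ∫ ω, Real.exp (τ * |x ω * y ω|) ∂μ ≤ A := by
  have hle : ∀ ω, Real.exp (τ * |x ω * y ω|)
      ≤ (Real.exp (τ * x ω ^ 2) + Real.exp (τ * y ω ^ 2)) / 2 := by
    intro ω
    -- AM-GM is applied twice, to the exponent and then to the exponentials, so the bound `A` is not
    -- degraded.
    have h1 : τ * |x ω * y ω| ≤ τ * x ω ^ 2 / 2 + τ * y ω ^ 2 / 2 := by
      rw [abs_mul, ← sq_abs (x ω), ← sq_abs (y ω)]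
      nlinarith [sq_nonneg (|x ω| - |y ω|)]
    refine (Real.exp_le_exp.2 h1).trans ?_
    rw [Real.exp_add]
    have e1 : Real.exp (τ * x ω ^ 2) = Real.exp (τ * x ω ^ 2 / 2) ^ 2 := by
      rw [← Real.exp_nat_mul]; congr 1; push_cast; ring
    have e2 : Real.exp (τ * y ω ^ 2) = Real.exp (τ * y ω ^ 2 / 2) ^ 2 := by
      rw [← Real.exp_nat_mul]; congr 1; push_cast; ring
    rw [e1, e2]
    nlinarith [sq_nonneg (Real.exp (τ * x ω ^ 2 / 2) - Real.exp (τ * y ω ^ 2 / 2))]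
  have hint : Integrable (fun ω => (Real.exp (τ * x ω ^ 2) + Real.exp (τ * y ω ^ 2)) / 2) μ :=
    (hxi.add hyi).div_const 2
  have hi : Integrable (fun ω => Real.exp (τ * |x ω * y ω|)) μ := by
    refine hint.mono' (by fun_prop) (Filter.Eventually.of_forall fun ω => ?_)
    rw [Real.norm_eq_abs, abs_of_pos (Real.exp_pos _)]
    exact hle ω
  refine ⟨hi, (integral_mono hi hint hle).trans ?_⟩
  rw [integral_div, integral_add hxi hyi]
  linarith

/-- Keeping the linear term exact lets the mean appear with coefficient exactly `t` in the bound on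
the moment generating function. -/
lemma exp_le_one_add_add_sq_mul_exp_abs (u : ℝ) :
    Real.exp u ≤ 1 + u + u ^ 2 * Real.exp |u| := by
  have h1 : 1 ≤ Real.exp |u| := Real.one_le_exp (abs_nonneg u)
  rcases le_or_gt |u| 1 with h | h
  · have := (abs_le.1 (Real.abs_exp_sub_one_sub_id_le h)).2
    nlinarith [sq_nonneg u]
  · rcases le_or_gt 0 u with hu | hu
    · rw [abs_of_nonneg hu] at *
      nlinarith [mul_le_mul_of_nonneg_right (show 1 ≤ u ^ 2 by nlinarith) (Real.exp_pos u).le]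
    · rw [abs_of_neg hu] at *
      have h2 : Real.exp u ≤ 1 := Real.exp_le_one_iff.2 hu.le
      nlinarith [Real.exp_pos u]

lemma integrable_of_exp_abs_moment {w : Ω → ℝ} (hw : Measurable w) {τ : ℝ} (hτ : 0 < τ)
    (hi : Integrable (fun ω => Real.exp (τ * |w ω|)) μ) : Integrable w μ := by
  refine (hi.div_const τ).mono' (by fun_prop) (Filter.Eventually.of_forall fun ω => ?_)
  rw [Real.norm_eq_abs, le_div_iff₀ hτ]
  linarith [Real.add_one_le_exp (τ * |w ω|)]

lemma abs_integral_le_of_exp_abs_moment {w : Ω → ℝ} (hw : Measurable w) {τ A : ℝ} (hτ : 0 < τ)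
    (hi : Integrable (fun ω => Real.exp (τ * |w ω|)) μ)
    (hA : ∫ ω, Real.exp (τ * |w ω|) ∂μ ≤ A) : |∫ ω, w ω ∂μ| ≤ A / τ := by
  refine abs_integral_le_integral_abs.trans ?_
  refine le_trans (integral_mono (integrable_of_exp_abs_moment hw hτ hi).abs (hi.div_const τ)
    fun ω => ?_) ?_
  · simp only
    rw [le_div_iff₀ hτ]
    linarith [Real.add_one_le_exp (τ * |w ω|)]
  · rw [integral_div]
    gcongr

lemma integrable_exp_mul_of_exp_abs_moment {w : Ω → ℝ} (hw : Measurable w) {τ t : ℝ}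
    (hi : Integrable (fun ω => Real.exp (τ * |w ω|)) μ) (ht : |t| ≤ τ) :
    Integrable (fun ω => Real.exp (t * w ω)) μ := by
  refine hi.mono' (by fun_prop) (Filter.Eventually.of_forall fun ω => ?_)
  rw [Real.norm_eq_abs, abs_of_pos (Real.exp_pos _), Real.exp_le_exp]
  calc t * w ω ≤ |t * w ω| := le_abs_self _
    _ = |t| * |w ω| := abs_mul _ _
    _ ≤ _ := by gcongr

/-- Bernstein's bound on the moment generating function of a sub-exponential variable. -/
lemma mgf_le_of_exp_abs_moment [IsProbabilityMeasure μ] {w : Ω → ℝ} (hw : Measurable w)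
    {τ A t : ℝ} (hτ : 0 < τ) (hi : Integrable (fun ω => Real.exp (τ * |w ω|)) μ)
    (hA : ∫ ω, Real.exp (τ * |w ω|) ∂μ ≤ A) (ht : |t| ≤ τ / 2) :
    mgf w μ t ≤ Real.exp (t * ∫ ω, w ω ∂μ + 8 * A / τ ^ 2 * t ^ 2) := by
  have hwi := integrable_of_exp_abs_moment hw hτ hi
  have hle : ∀ ω, Real.exp (t * w ω)
      ≤ 1 + t * w ω + 8 / τ ^ 2 * t ^ 2 * Real.exp (τ * |w ω|) := by
    intro ω
    refine (exp_le_one_add_add_sq_mul_exp_abs _).trans ?_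
    -- Half of the exponent `τ |w|` absorbs `exp |t w|`, which is why `|t| ≤ τ / 2`; the other half
    -- absorbs the factor `w²` through `y² ≤ 2 exp y`.
    have h1 : |t * w ω| ≤ τ * |w ω| / 2 := by
      rw [abs_mul]; nlinarith [abs_nonneg (w ω)]
    have h2 : (τ * |w ω| / 2) ^ 2 ≤ 2 * Real.exp (τ * |w ω| / 2) := by
      have := Real.quadratic_le_exp_of_nonneg (x := τ * |w ω| / 2) (by positivity)
      have : 0 ≤ τ * |w ω| / 2 := by positivity
      linarith
    have h3 : Real.exp (τ * |w ω|) = Real.exp (τ * |w ω| / 2) * Real.exp (τ * |w ω| / 2) := by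
      rw [← Real.exp_add]; congr 1; ring
    have h4 : (t * w ω) ^ 2 ≤ 8 / τ ^ 2 * t ^ 2 * Real.exp (τ * |w ω| / 2) := by
      have : (t * w ω) ^ 2 = 4 / τ ^ 2 * t ^ 2 * (τ * |w ω| / 2) ^ 2 := by
        rw [div_pow, mul_pow, mul_pow, sq_abs]; field_simp; norm_num
      rw [this]
      calc _ ≤ 4 / τ ^ 2 * t ^ 2 * (2 * Real.exp (τ * |w ω| / 2)) := by gcongr
        _ = _ := by ring
    have h5 : (t * w ω) ^ 2 * Real.exp |t * w ω|
        ≤ 8 / τ ^ 2 * t ^ 2 * Real.exp (τ * |w ω|) := by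
      rw [h3, ← mul_assoc]
      exact mul_le_mul h4 (Real.exp_le_exp.2 h1) (Real.exp_pos _).le (by positivity)
    linarith
  have hint : Integrable (fun ω => 1 + t * w ω + 8 / τ ^ 2 * t ^ 2 * Real.exp (τ * |w ω|)) μ :=
    ((integrable_const 1).add (hwi.const_mul t)).add (hi.const_mul _)
  have hti : |t| ≤ τ := ht.trans (by linarith)
  calc mgf w μ t ≤ ∫ ω, (1 + t * w ω + 8 / τ ^ 2 * t ^ 2 * Real.exp (τ * |w ω|)) ∂μ :=
        integral_mono (integrable_exp_mul_of_exp_abs_moment hw hi hti) hint hle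
    _ = 1 + t * ∫ ω, w ω ∂μ + 8 / τ ^ 2 * t ^ 2 * ∫ ω, Real.exp (τ * |w ω|) ∂μ := by
        have h1 := integral_add ((integrable_const (μ := μ) (1 : ℝ)).add (hwi.const_mul t))
          (hi.const_mul (8 / τ ^ 2 * t ^ 2))
        have h2 := integral_add (integrable_const (μ := μ) (1 : ℝ)) (hwi.const_mul t)
        simp only [Pi.add_apply] at h1
        rw [h1, h2, integral_const_mul, integral_const_mul]
        simp
    _ ≤ 1 + t * ∫ ω, w ω ∂μ + 8 / τ ^ 2 * t ^ 2 * A := by gcongr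
    _ = (t * ∫ ω, w ω ∂μ + 8 * A / τ ^ 2 * t ^ 2) + 1 := by ring
    _ ≤ _ := Real.add_one_le_exp _

/-- Bernstein's inequality for a finite sum of independent sub-exponential variables. -/
lemma measureReal_abs_sum_sub_integral_ge_le [IsProbabilityMeasure μ] {κ : Type*} [Fintype κ]
    {w : κ → Ω → ℝ} (hw : ∀ i, Measurable (w i)) (hind : iIndepFun w μ) {τ A t s : ℝ}
    (hτ : 0 < τ) (hi : ∀ i, Integrable (fun ω => Real.exp (τ * |w i ω|)) μ)
    (hA : ∀ i, ∫ ω, Real.exp (τ * |w i ω|) ∂μ ≤ A) (ht0 : 0 ≤ t) (ht : t ≤ τ / 2) :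
    μ.real {ω | s ≤ |∑ i, w i ω - ∑ i, ∫ ω', w i ω' ∂μ|}
      ≤ 2 * Real.exp (-t * s + 8 * A / τ ^ 2 * t ^ 2 * Fintype.card κ) := by
  set m := ∑ i, ∫ ω', w i ω' ∂μ with hm
  have hmgf : ∀ u : ℝ, |u| ≤ τ / 2 → mgf (∑ i, w i) μ u
      ≤ Real.exp (u * m + 8 * A / τ ^ 2 * u ^ 2 * Fintype.card κ) := by
    intro u hu
    rw [hind.mgf_sum hw]
    calc ∏ i, mgf (w i) μ u
        ≤ ∏ i, Real.exp (u * ∫ ω, w i ω ∂μ + 8 * A / τ ^ 2 * u ^ 2) :=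
          Finset.prod_le_prod (fun i _ => mgf_nonneg)
            fun i _ => mgf_le_of_exp_abs_moment (hw i) hτ (hi i) (hA i) hu
      _ = _ := by
          rw [← Real.exp_sum, Finset.sum_add_distrib, ← Finset.mul_sum]
          simp [hm, mul_comm]
  have hint : ∀ u : ℝ, |u| ≤ τ / 2 →
      Integrable (fun ω => Real.exp (u * (∑ i, w i) ω)) μ := fun u hu =>
    hind.integrable_exp_mul_sum hw fun i _ =>
      integrable_exp_mul_of_exp_abs_moment (hw i) (hi i) (hu.trans (by linarith))
  have habs : |t| ≤ τ / 2 := by rwa [abs_of_nonneg ht0]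
  have habs' : |-t| ≤ τ / 2 := by rwa [abs_neg]
  have hup : μ.real {ω | m + s ≤ (∑ i, w i) ω}
      ≤ Real.exp (-t * s + 8 * A / τ ^ 2 * t ^ 2 * Fintype.card κ) := by
    refine (measure_ge_le_exp_mul_mgf (m + s) ht0 (hint t habs)).trans ?_
    refine (mul_le_mul_of_nonneg_left (hmgf t habs) (Real.exp_pos _).le).trans (le_of_eq ?_)
    rw [← Real.exp_add]; congr 1; ring
  have hlo : μ.real {ω | (∑ i, w i) ω ≤ m - s}
      ≤ Real.exp (-t * s + 8 * A / τ ^ 2 * t ^ 2 * Fintype.card κ) := by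
    refine (measure_le_le_exp_mul_mgf (m - s) (neg_nonpos.2 ht0) (hint (-t) habs')).trans ?_
    refine (mul_le_mul_of_nonneg_left (hmgf (-t) habs') (Real.exp_pos _).le).trans (le_of_eq ?_)
    rw [← Real.exp_add]; congr 1; ring
  have hsub : {ω | s ≤ |∑ i, w i ω - m|}
      ⊆ {ω | m + s ≤ (∑ i, w i) ω} ∪ {ω | (∑ i, w i) ω ≤ m - s} := by
    intro ω hω
    simp only [Set.mem_ofPred_eq, Set.mem_union, Finset.sum_apply] at hω ⊢
    rcases le_abs.1 hω with h | h
    · left; linarith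
    · right; linarith
  calc _ ≤ _ := measureReal_mono hsub
    _ ≤ _ := measureReal_union_le _ _
    _ ≤ _ := by linarith

end

/-! ### Nets of the unit sphere. -/

section Net

/-- The unit sphere of a finite-dimensional normed space has a `1/2`-net of cardinality at most
`5 ^ dim`. -/
lemma exists_half_net_unit_sphere (E : Type*) [NormedAddCommGroup E] [NormedSpace ℝ E]
    [FiniteDimensional ℝ E] :
    ∃ N : Finset E, N.card ≤ 5 ^ Module.finrank ℝ E ∧ (∀ a ∈ N, ‖a‖ = 1) ∧
      ∀ u : E, ‖u‖ = 1 → ∃ a ∈ N, ‖u - a‖ ≤ 1 / 2 := by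
  classical
  let P : Finset E → Prop := fun N =>
    (∀ a ∈ N, ‖a‖ = 1) ∧ ∀ a ∈ N, ∀ b ∈ N, a ≠ b → 1 / 2 ≤ ‖a - b‖
  have hcard : ∀ N, P N → N.card ≤ 5 ^ Module.finrank ℝ E := by
    intro N hN
    -- Doubling turns a `1/2`-separated set of unit vectors into a `1`-separated set in the ball of
    -- radius `2`, the setting of `Besicovitch.card_le_of_separated`.
    have hinj : Function.Injective fun a : E => (2 : ℝ) • a :=
      smul_right_injective E two_ne_zero
    rw [← Finset.card_image_of_injective N hinj]
    apply Besicovitch.card_le_of_separated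
    · intro c hc
      obtain ⟨a, ha, rfl⟩ := Finset.mem_image.1 hc
      simp [norm_smul, hN.1 a ha]
    · intro c hc d hd hcd
      obtain ⟨a, ha, rfl⟩ := Finset.mem_image.1 hc
      obtain ⟨b, hb, rfl⟩ := Finset.mem_image.1 hd
      have := hN.2 a ha b hb fun h => hcd (by rw [h])
      rw [← smul_sub, norm_smul, Real.norm_ofNat]
      linarith
  -- A separated set of largest cardinality is a net: a point far from all of it could be added.
  let Q : ℕ → Prop := fun k => ∃ N, P N ∧ N.card = k
  have hQ0 : Q 0 := ⟨∅, by simp [P], rfl⟩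
  obtain ⟨N, hN, hNk⟩ := Nat.findGreatest_spec (P := Q) (Nat.zero_le (5 ^ Module.finrank ℝ E)) hQ0
  refine ⟨N, hcard N hN, hN.1, fun u hu => ?_⟩
  by_contra! hcon
  have huN : u ∉ N := fun h => by
    have := hcon u h
    rw [sub_self, norm_zero] at this
    norm_num at this
  have hins : P (insert u N) := by
    refine ⟨fun a ha => ?_, fun a ha b hb hab => ?_⟩
    · rcases Finset.mem_insert.1 ha with rfl | ha
      · exact hu
      · exact hN.1 a ha
    · rcases Finset.mem_insert.1 ha with ha | ha <;> rcases Finset.mem_insert.1 hb with hb | hb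
      · exact absurd (ha.trans hb.symm) hab
      · rw [ha]; exact (hcon b hb).le
      · rw [hb, norm_sub_rev]; exact (hcon a ha).le
      · exact hN.2 a ha b hb hab
  have h1 := Nat.le_findGreatest (P := Q) (hcard _ hins) ⟨_, hins, rfl⟩
  rw [← hNk, Finset.card_insert_of_notMem huN] at h1
  omega

variable {E F : Type*} [NormedAddCommGroup E] [NormedSpace ℝ E] [FiniteDimensional ℝ E]
  [NormedAddCommGroup F] [NormedSpace ℝ F] [FiniteDimensional ℝ F]

/-- A linear functional is controlled by its values on a `1/2`-net of the unit sphere. -/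
lemma abs_le_of_half_net {N : Finset E}
    (hN : ∀ u : E, ‖u‖ = 1 → ∃ a ∈ N, ‖u - a‖ ≤ 1 / 2) (f : E →ₗ[ℝ] ℝ) {K : ℝ} (hK : 0 ≤ K)
    (h : ∀ a ∈ N, |f a| ≤ K) (u : E) : |f u| ≤ 2 * K * ‖u‖ := by
  let g : E →L[ℝ] ℝ := f.toContinuousLinearMap
  -- A self-bounding estimate: the net error costs half of `‖g‖`, which moves to the left side and
  -- gives `‖g‖ ≤ 2 K`.
  have hg : ‖g‖ ≤ K + ‖g‖ / 2 := by
    apply ContinuousLinearMap.opNorm_le_of_unit_norm (by positivity)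
    intro v hv
    obtain ⟨a, ha, hva⟩ := hN v hv
    have e : g v = g a + g (v - a) := by simp
    have h1 : ‖g a‖ ≤ K := h a ha
    have h2 : ‖g (v - a)‖ ≤ ‖g‖ * (1 / 2) := (g.le_opNorm _).trans (by gcongr)
    rw [e]
    exact (norm_add_le _ _).trans (by linarith)
  have h3 : ‖g u‖ ≤ 2 * K * ‖u‖ := (g.le_opNorm u).trans (by gcongr; linarith)
  exact h3

/-- A bilinear form is controlled by its values on `1/2`-nets of the unit spheres. -/
lemma abs_bilin_le_of_half_net {N : Finset E} {N' : Finset F}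
    (hN : ∀ u : E, ‖u‖ = 1 → ∃ a ∈ N, ‖u - a‖ ≤ 1 / 2)
    (hN' : ∀ u : F, ‖u‖ = 1 → ∃ a ∈ N', ‖u - a‖ ≤ 1 / 2)
    (f : E →ₗ[ℝ] F →ₗ[ℝ] ℝ) {K : ℝ} (hK : 0 ≤ K)
    (h : ∀ a ∈ N, ∀ b ∈ N', |f a b| ≤ K) (u : E) (v : F) : |f u v| ≤ 4 * K * ‖u‖ * ‖v‖ := by
  have h1 : ∀ a ∈ N, |f.flip v a| ≤ 2 * K * ‖v‖ := fun a ha =>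
    abs_le_of_half_net hN' (f a) hK (h a ha) v
  have h2 := abs_le_of_half_net hN (f.flip v) (by positivity) h1 u
  rw [LinearMap.flip_apply] at h2
  linarith

end Net

/-! ### Three-colouring a permutation. -/

/-- The points of a finite type can be coloured with three colours so that a permutation
preserves the colour of its fixed points only. -/
lemma exists_three_coloring {α : Type*} [Fintype α] [DecidableEq α] (π : Equiv.Perm α) :
    ∃ c : α → Fin 3, ∀ i, π i ≠ i → c (π i) ≠ c i := by
  suffices h : ∀ T : Finset α, ∃ c : α → Fin 3, ∀ i ∈ T, π i ∈ T → π i ≠ i → c (π i) ≠ c i by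
    obtain ⟨c, hc⟩ := h Finset.univ
    exact ⟨c, fun i => hc i (Finset.mem_univ _) (Finset.mem_univ _)⟩
  intro T
  induction T using Finset.induction_on with
  | empty => exact ⟨fun _ => 0, by simp⟩
  | insert x T hx ih =>
    obtain ⟨c, hc⟩ := ih
    -- A new point only has to avoid the colours of its image and its preimage, so a third colour is
    -- free.
    have hfree : ∀ y z : Fin 3, ∃ v, v ≠ y ∧ v ≠ z := by decide
    obtain ⟨v, hv1, hv2⟩ := hfree (c (π x)) (c (π.symm x))
    refine ⟨Function.update c x v, fun i hi hπi hne => ?_⟩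
    by_cases hix : i = x
    · subst hix
      rw [Function.update_of_ne hne, Function.update_self]
      exact hv1.symm
    · by_cases hπx : π i = x
      · rw [hπx, Function.update_self, Function.update_of_ne hix]
        rwa [← hπx, Equiv.symm_apply_apply] at hv2
      · rw [Function.update_of_ne hπx, Function.update_of_ne hix]
        exact hc i (Finset.mem_of_mem_insert_of_ne hi hix)
          (Finset.mem_of_mem_insert_of_ne hπi hπx) hne

/-! ### Orthogonal projections and angles between subspaces. -/

section Projection

variable {E : Type*} [NormedAddCommGroup E] [InnerProductSpace ℝ E] [FiniteDimensional ℝ E]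

lemma starProjection_eq_add_of_le {U W : Submodule ℝ E} (h : U ≤ W) (x : E) :
    W.starProjection x = U.starProjection x + W.starProjection (x - U.starProjection x) := by
  rw [map_sub, Submodule.starProjection_eq_self_iff.2
    (h (Submodule.starProjection_apply_mem U x))]
  abel

/-- Pythagoras for the projection onto a larger subspace. -/
lemma norm_sq_starProjection_eq_add_of_le {U W : Submodule ℝ E} (h : U ≤ W) (x : E) :
    ‖W.starProjection x‖ ^ 2 = ‖U.starProjection x‖ ^ 2
      + ‖W.starProjection (x - U.starProjection x)‖ ^ 2 := by
  rw [starProjection_eq_add_of_le h x, norm_add_sq_real, real_inner_comm,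
    Submodule.inner_starProjection_left_eq_right,
    Submodule.starProjection_eq_self_iff.2 (h (Submodule.starProjection_apply_mem U x)),
    Submodule.starProjection_inner_eq_zero _ _ (Submodule.starProjection_apply_mem U x)]
  ring

lemma inner_starProjection_self_eq_norm_sq (U : Submodule ℝ E) (x : E) :
    inner ℝ x (U.starProjection x) = ‖U.starProjection x‖ ^ 2 := by
  rw [← real_inner_self_eq_norm_sq, Submodule.inner_starProjection_left_eq_right,
    Submodule.starProjection_eq_self_iff.2 (Submodule.starProjection_apply_mem U x)]

/-- The projection onto `V` factors through the one onto `W`, and projections are contractions. -/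
lemma norm_starProjection_le_of_le {V W : Submodule ℝ E} (h : V ≤ W) (x : E) :
    ‖V.starProjection x‖ ≤ ‖W.starProjection x‖ := by
  have := DFunLike.congr_fun (Submodule.starProjection_comp_starProjection_of_le h) x
  rw [← this]
  exact Submodule.norm_starProjection_apply_le _ _

/-- If the cosine of the angle between `U` and `V` is at most `√ε`, then on the orthogonal
complement of `U` the projection onto `U ⊔ V` is controlled by the projection onto `V`. -/
lemma norm_sq_starProjection_sup_le {U V : Submodule ℝ E} {ε : ℝ}
    (hε0 : 0 ≤ ε) (hε1 : ε < 1)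
    (h : ∀ u ∈ U, ∀ v ∈ V, inner ℝ u v ^ 2 ≤ ε * ‖u‖ ^ 2 * ‖v‖ ^ 2) {r : E} (hr : r ∈ Uᗮ) :
    ‖(U ⊔ V).starProjection r‖ ^ 2 ≤ 1 / (1 - ε) * ‖V.starProjection r‖ ^ 2 := by
  set y := (U ⊔ V).starProjection r with hy
  have hyU : ∀ u ∈ U, inner ℝ u y = 0 := by
    intro u hu
    rw [hy, ← Submodule.inner_starProjection_left_eq_right,
      Submodule.starProjection_eq_self_iff.2 (le_sup_left (b := V) hu)]
    exact hr u hu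
  have hBr : V.starProjection r = V.starProjection y :=
    (DFunLike.congr_fun (Submodule.starProjection_comp_starProjection_of_le
      (le_sup_right (a := U) (b := V))) r).symm
  have hyW : y ∈ U ⊔ V := Submodule.starProjection_apply_mem _ _
  obtain ⟨u, hu, v, hv, huv⟩ := Submodule.mem_sup.1 hyW
  have hvy : inner ℝ v y = ‖y‖ ^ 2 := by
    rw [← real_inner_self_eq_norm_sq]
    nth_rw 2 [← huv]
    rw [inner_add_left, hyU u hu, zero_add]
  have hle : ‖y‖ ^ 2 ≤ ‖v‖ * ‖V.starProjection y‖ := by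
    rw [← hvy]
    nth_rw 1 [← Submodule.starProjection_eq_self_iff.2 hv]
    rw [Submodule.inner_starProjection_left_eq_right]
    exact real_inner_le_norm _ _
  have huu : inner ℝ u v = -‖u‖ ^ 2 := by
    have := hyU u hu
    rw [← huv, inner_add_right, real_inner_self_eq_norm_sq] at this
    linarith
  have hvn : ‖v‖ ^ 2 = ‖y‖ ^ 2 + ‖u‖ ^ 2 := by
    have : v = y - u := by rw [← huv]; abel
    rw [this, norm_sub_sq_real, real_inner_comm, hyU u hu]
    ring
  -- With `y = u + v` and `y ⊥ U`, one has `⟨u, v⟩ = -‖u‖²`, so the angle condition bounds `u` by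
  -- `v`. Hence `(1 - ε) ‖v‖² ≤ ‖y‖²`, to be combined with `‖y‖² ≤ ‖v‖ ‖P_V y‖`.
  have hε : ‖u‖ ^ 2 ≤ ε * ‖v‖ ^ 2 := by
    have h1 := h u hu v hv
    rw [huu] at h1
    rcases (sq_nonneg ‖u‖).eq_or_lt with h0 | h0
    · rw [← h0]; positivity
    · have h2 : ‖u‖ ^ 2 * ‖u‖ ^ 2 ≤ ‖u‖ ^ 2 * (ε * ‖v‖ ^ 2) := by nlinarith
      exact le_of_mul_le_mul_left h2 h0
  rw [hBr, one_div, ← div_eq_inv_mul, le_div_iff₀ (by linarith)]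
  rcases (sq_nonneg ‖y‖).eq_or_lt with h0 | h0
  · rw [← h0]; simp
  have h3 : ‖y‖ ^ 2 * ‖y‖ ^ 2 ≤ ‖v‖ ^ 2 * ‖V.starProjection y‖ ^ 2 := by
    rw [← mul_pow (‖v‖), ← sq (‖y‖ ^ 2)]
    exact pow_le_pow_left₀ (by positivity) hle 2
  have hv0 : 0 < ‖v‖ ^ 2 := by nlinarith [sq_nonneg ‖u‖]
  have h4 : ‖v‖ ^ 2 * (‖y‖ ^ 2 * (1 - ε)) ≤ ‖v‖ ^ 2 * ‖V.starProjection y‖ ^ 2 := by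
    nlinarith
  exact le_of_mul_le_mul_left h4 hv0

end Projection

/-! ### Uniform concentration of bilinear forms in the rows. -/

section

variable {Ω : Type*} [MeasurableSpace Ω] {μ : Measure Ω}

/-- Functions of disjoint blocks of an independent family are independent. -/
lemma iIndepFun_comp_of_pairwise_disjoint {ι κ : Type*} {β γ : Type*}
    [MeasurableSpace β] [MeasurableSpace γ] {z : ι → Ω → β} (hz : iIndepFun z μ)
    (hm : ∀ i, Measurable (z i)) (T : κ → Finset ι)
    (hT : ∀ k l, k ≠ l → Disjoint (T k) (T l)) (φ : ∀ k, (T k → β) → γ)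
    (hφ : ∀ k, Measurable (φ k)) :
    iIndepFun (fun k ω => φ k fun i => z i ω) μ := by
  classical
  have := hz.isProbabilityMeasure
  rw [iIndepFun_iff_measure_inter_preimage_eq_mul]
  intro S sets
  induction S using Finset.induction_on with
  | empty => simp
  | insert k S hk ih =>
    intro hs
    rw [Finset.prod_insert hk, ← ih fun i hi => hs i (Finset.mem_insert_of_mem hi)]
    have hdisj : Disjoint (T k) (S.biUnion T) := by
      rw [Finset.disjoint_biUnion_right]
      exact fun j hj => hT k j fun h => hk (h ▸ hj)
    have hind := hz.indepFun_finset (T k) (S.biUnion T) hdisj hm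
    -- The joint event of the remaining blocks is written as one event `B` in the coordinates of
    -- their union, which is disjoint from `T k`.
    have hsub : ∀ j : S, T j ⊆ S.biUnion T := fun j => Finset.subset_biUnion_of_mem T j.2
    let B : Set (S.biUnion T → β) :=
      ⋂ j : S, (fun y => φ j fun i => y ⟨i, hsub j i.2⟩) ⁻¹' sets j
    have hB : MeasurableSet B := MeasurableSet.iInter fun j =>
      ((hφ j).comp (by fun_prop)) (hs j (Finset.mem_insert_of_mem j.2))
    have h1 := hind.measure_inter_preimage_eq_mul (φ k ⁻¹' sets k) B
      (hφ k (hs k (Finset.mem_insert_self k S))) hB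
    have h2 : (fun ω => fun i : S.biUnion T => z i ω) ⁻¹' B
        = ⋂ j ∈ S, (fun ω => φ j fun i => z i ω) ⁻¹' sets j := by
      ext ω; simp [B]
    rw [h2] at h1
    rw [Finset.set_biInter_insert]
    exact h1

variable {n d : ℕ} {Z : Ω → Matrix (Fin n) (Fin d) ℝ} {τ : ℝ}

lemma measurable_row_dotProduct (hZ : ∀ r, Measurable fun ω => Z ω r) (r : Fin n)
    (v : Fin d → ℝ) : Measurable fun ω => Z ω r ⬝ᵥ v := by
  simp only [dotProduct]
  have : ∀ i, Measurable fun ω => Z ω r i := fun i => (measurable_pi_apply i).comp (hZ r)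
  fun_prop

lemma exists_unit_smul {E : Type*} [NormedAddCommGroup E] [NormedSpace ℝ E] {a : E}
    (ha : a ≠ 0) : ∃ u : E, ‖u‖ = 1 ∧ a = ‖a‖ • u :=
  ⟨‖a‖⁻¹ • a, norm_smul_inv_norm ha, by
    rw [smul_smul, mul_inv_cancel₀ (norm_ne_zero_iff.2 ha), one_smul]⟩

/-- Second moments of the rows under an exponential square moment condition. -/
lemma integrable_and_abs_integral_row_mul_row (hZ : ∀ r, Measurable fun ω => Z ω r)
    (hτ : 0 < τ)
    (hexp : ∀ r (v : EuclideanSpace ℝ (Fin d)), ‖v‖ = 1 →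
      Integrable (fun ω => Real.exp (τ * (Z ω r ⬝ᵥ v.ofLp) ^ 2)) μ ∧
        ∫ ω, Real.exp (τ * (Z ω r ⬝ᵥ v.ofLp) ^ 2) ∂μ ≤ 2)
    (i j : Fin n) (a b : EuclideanSpace ℝ (Fin d)) :
    Integrable (fun ω => (Z ω i ⬝ᵥ a.ofLp) * (Z ω j ⬝ᵥ b.ofLp)) μ ∧
      |∫ ω, (Z ω i ⬝ᵥ a.ofLp) * (Z ω j ⬝ᵥ b.ofLp) ∂μ| ≤ 2 / τ * ‖a‖ * ‖b‖ := by
  by_cases ha : a = 0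
  · simp [ha]
  by_cases hb : b = 0
  · simp [hb]
  obtain ⟨u, hu, hau⟩ := exists_unit_smul ha
  obtain ⟨v, hv, hbv⟩ := exists_unit_smul hb
  have hxm := measurable_row_dotProduct hZ i u.ofLp
  have hym := measurable_row_dotProduct hZ j v.ofLp
  have h := exp_abs_mul_moment hxm hym hτ (hexp i u hu).1 (hexp j v hv).1
    (hexp i u hu).2 (hexp j v hv).2
  have e : (fun ω => (Z ω i ⬝ᵥ a.ofLp) * (Z ω j ⬝ᵥ b.ofLp))
      = fun ω => (‖a‖ * ‖b‖) * ((Z ω i ⬝ᵥ u.ofLp) * (Z ω j ⬝ᵥ v.ofLp)) := by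
    funext ω
    rw [congrArg WithLp.ofLp hau, congrArg WithLp.ofLp hbv, WithLp.ofLp_smul, WithLp.ofLp_smul,
      dotProduct_smul, dotProduct_smul, smul_eq_mul, smul_eq_mul]
    ring
  rw [e]
  refine ⟨(integrable_of_exp_abs_moment (hxm.mul hym) hτ h.1).const_mul _, ?_⟩
  rw [integral_const_mul, abs_mul, abs_of_nonneg (by positivity)]
  have := abs_integral_le_of_exp_abs_moment (hxm.mul hym) hτ h.1 h.2
  calc _ ≤ ‖a‖ * ‖b‖ * (2 / τ) := by gcongr; exact this
    _ = _ := by ring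

/-- Uniform concentration of the bilinear forms `(a, b) ↦ ∑ i ∈ S, ⟨zᵢ, a⟩ ⟨z_{σ i}, b⟩`, when
the blocks `{i, σ i}`, `i ∈ S`, are disjoint. -/
lemma exists_event_bilin_concentration [IsProbabilityMeasure μ]
    (hZ : ∀ r, Measurable fun ω => Z ω r) (hind : iIndepFun (fun r ω => Z ω r) μ)
    (hτ : 0 < τ)
    (hexp : ∀ r (v : EuclideanSpace ℝ (Fin d)), ‖v‖ = 1 →
      Integrable (fun ω => Real.exp (τ * (Z ω r ⬝ᵥ v.ofLp) ^ 2)) μ ∧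
        ∫ ω, Real.exp (τ * (Z ω r ⬝ᵥ v.ofLp) ^ 2) ∂μ ≤ 2)
    (S : Finset (Fin n)) (σ : Fin n → Fin n)
    (hS : ∀ i ∈ S, ∀ j ∈ S, i ≠ j → i ≠ σ j ∧ σ i ≠ σ j)
    {p s t : ℝ} (hdp : d ≤ p) (hs : 0 ≤ s) (ht0 : 0 ≤ t) (ht : t ≤ τ / 2)
    (hst : 5 * p + 16 / τ ^ 2 * t ^ 2 * S.card ≤ t * s) :
    ∃ G : Set Ω, MeasurableSet G ∧ μ.real Gᶜ ≤ 2 * Real.exp (-p) ∧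
      ∀ ω ∈ G, ∀ a b : EuclideanSpace ℝ (Fin d),
        |∑ i ∈ S, (Z ω i ⬝ᵥ a.ofLp) * (Z ω (σ i) ⬝ᵥ b.ofLp)
          - ∑ i ∈ S, ∫ ω', (Z ω' i ⬝ᵥ a.ofLp) * (Z ω' (σ i) ⬝ᵥ b.ofLp) ∂μ|
          ≤ 4 * s * ‖a‖ * ‖b‖ := by
  obtain ⟨N, hNcard, hNunit, hN⟩ := exists_half_net_unit_sphere (EuclideanSpace ℝ (Fin d))
  rw [finrank_euclideanSpace_fin] at hNcard
  let D : EuclideanSpace ℝ (Fin d) → EuclideanSpace ℝ (Fin d) → Ω → ℝ := fun a b ω =>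
    ∑ i ∈ S, (Z ω i ⬝ᵥ a.ofLp) * (Z ω (σ i) ⬝ᵥ b.ofLp)
      - ∑ i ∈ S, ∫ ω', (Z ω' i ⬝ᵥ a.ofLp) * (Z ω' (σ i) ⬝ᵥ b.ofLp) ∂μ
  have hm := measurable_row_dotProduct hZ
  have hDm : ∀ a b, Measurable (D a b) := fun a b => by
    have := fun i => hm i a.ofLp
    have := fun i => hm i b.ofLp
    fun_prop
  let bad : EuclideanSpace ℝ (Fin d) × EuclideanSpace ℝ (Fin d) → Set Ω :=
    fun q => {ω | s ≤ |D q.1 q.2 ω|}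
  have hbadm : ∀ q, MeasurableSet (bad q) := fun q =>
    measurableSet_le measurable_const (hDm q.1 q.2).abs
  -- The rate `5 p` pays for the union bound: there are at most `5 ^ (2 d) ≤ exp (4 p)` pairs, which
  -- leaves `exp (-p)`.
  have hbad : ∀ q ∈ N ×ˢ N, μ.real (bad q) ≤ 2 * Real.exp (-(5 * p)) := by
    rintro ⟨a, b⟩ hq
    obtain ⟨ha, hb⟩ := Finset.mem_product.1 hq
    have h := fun i => exp_abs_mul_moment (hm i a.ofLp) (hm (σ i) b.ofLp) hτ
      (hexp i a (hNunit a ha)).1 (hexp (σ i) b (hNunit b hb)).1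
      (hexp i a (hNunit a ha)).2 (hexp (σ i) b (hNunit b hb)).2
    have hw : iIndepFun (fun (i : S) ω => (Z ω i ⬝ᵥ a.ofLp) * (Z ω (σ i) ⬝ᵥ b.ofLp)) μ := by
      refine iIndepFun_comp_of_pairwise_disjoint hind hZ (fun k : S => {k.1, σ k})
        (fun k l hkl => ?_)
        (fun k y => (y ⟨k, by simp⟩ ⬝ᵥ a.ofLp) * (y ⟨σ k, by simp⟩ ⬝ᵥ b.ofLp)) fun k => ?_
      · have hkl' : k.1 ≠ l.1 := fun e => hkl (Subtype.ext e)
        have h1 := hS k k.2 l l.2 hkl'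
        have h2 := hS l l.2 k k.2 hkl'.symm
        simp only [Finset.disjoint_insert_left, Finset.disjoint_singleton_left,
          Finset.mem_insert, Finset.mem_singleton, not_or]
        exact ⟨⟨hkl', h1.1⟩, h2.1.symm, h1.2⟩
      · simp only [dotProduct]
        fun_prop
    have hbern := measureReal_abs_sum_sub_integral_ge_le (t := t) (s := s)
      (fun i : S => (hm i a.ofLp).mul (hm (σ i) b.ofLp)) hw hτ (fun i => (h i).1)
      (fun i => (h i).2) ht0 ht
    have e1 : ∀ f : Fin n → ℝ, ∑ i : S, f i = ∑ i ∈ S, f i := fun f =>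
      Finset.sum_coe_sort S f
    simp only [Pi.mul_apply] at hbern
    have e2 : ∀ ω, ∑ i : S, (Z ω i ⬝ᵥ a.ofLp) * (Z ω (σ i) ⬝ᵥ b.ofLp)
        = ∑ i ∈ S, (Z ω i ⬝ᵥ a.ofLp) * (Z ω (σ i) ⬝ᵥ b.ofLp) := fun ω =>
      e1 fun i => (Z ω i ⬝ᵥ a.ofLp) * (Z ω (σ i) ⬝ᵥ b.ofLp)
    simp_rw [e2, e1 fun i => ∫ ω', (Z ω' i ⬝ᵥ a.ofLp) * (Z ω' (σ i) ⬝ᵥ b.ofLp) ∂μ] at hbern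
    refine hbern.trans ?_
    rw [Fintype.card_coe]
    gcongr
    have : (8 : ℝ) * 2 = 16 := by norm_num
    rw [this]
    linarith
  have hNp : (N.card : ℝ) ≤ Real.exp (2 * p) := by
    have h5 : (5 : ℝ) ≤ Real.exp 2 := by
      have := Real.quadratic_le_exp_of_nonneg (x := 2) (by norm_num)
      linarith
    calc (N.card : ℝ) ≤ 5 ^ d := by exact_mod_cast hNcard
      _ ≤ Real.exp 2 ^ d := by gcongr
      _ = Real.exp (2 * d) := by rw [← Real.exp_nat_mul, mul_comm]
      _ ≤ _ := by gcongr
  refine ⟨(⋃ q ∈ N ×ˢ N, bad q)ᶜ,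
    (Finset.measurableSet_biUnion _ fun q _ => hbadm q).compl, ?_, ?_⟩
  · rw [compl_compl]
    calc μ.real (⋃ q ∈ N ×ˢ N, bad q) ≤ ∑ q ∈ N ×ˢ N, μ.real (bad q) :=
          measureReal_biUnion_finset_le _ _
      _ ≤ ∑ q ∈ N ×ˢ N, 2 * Real.exp (-(5 * p)) := Finset.sum_le_sum hbad
      _ = N.card * N.card * (2 * Real.exp (-(5 * p))) := by
          rw [Finset.sum_const, Finset.card_product, nsmul_eq_mul]; push_cast; ring
      _ ≤ Real.exp (2 * p) * Real.exp (2 * p) * (2 * Real.exp (-(5 * p))) := by gcongr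
      _ = 2 * (Real.exp (2 * p) * Real.exp (2 * p) * Real.exp (-(5 * p))) := by ring
      _ = 2 * Real.exp (-p) := by
          rw [← Real.exp_add, ← Real.exp_add]; congr 2; ring
  · intro ω hω a b
    have hint := integrable_and_abs_integral_row_mul_row hZ hτ hexp
    -- The centring term is itself bilinear, by integrability, so the net argument applies to the
    -- deviation directly.
    let f : EuclideanSpace ℝ (Fin d) →ₗ[ℝ] EuclideanSpace ℝ (Fin d) →ₗ[ℝ] ℝ :=
      LinearMap.mk₂ ℝ (fun a b => D a b ω)
        (fun a a' b => by
          simp only [D, WithLp.ofLp_add, dotProduct_add, add_mul]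
          simp_rw [integral_add (hint _ _ a b).1 (hint _ _ a' b).1, Finset.sum_add_distrib]
          ring)
        (fun c a b => by
          simp only [D, WithLp.ofLp_smul, dotProduct_smul, smul_eq_mul, mul_assoc]
          simp_rw [integral_const_mul, ← Finset.mul_sum]
          ring)
        (fun a b b' => by
          simp only [D, WithLp.ofLp_add, dotProduct_add, mul_add]
          simp_rw [integral_add (hint _ _ a b).1 (hint _ _ a b').1, Finset.sum_add_distrib]
          ring)
        (fun c a b => by
          simp only [D, WithLp.ofLp_smul, dotProduct_smul, smul_eq_mul, mul_left_comm _ c]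
          simp_rw [integral_const_mul, ← Finset.mul_sum]
          ring)
    refine abs_bilin_le_of_half_net hN hN f hs (fun a ha b hb => ?_) a b
    by_contra! hlt
    refine hω (Set.mem_biUnion (x := (a, b)) (Finset.mem_product.2 ⟨ha, hb⟩) ?_)
    exact hlt.le

end

/-! ### The two high-probability events. -/

section

variable {Ω : Type*} [MeasurableSpace Ω] {μ : Measure Ω}
  {n d : ℕ} {Z : Ω → Matrix (Fin n) (Fin d) ℝ} {τ : ℝ}

/-- Distinct independent centred rows are uncorrelated in all directions. -/
lemma integral_row_mul_row_eq_zero (hZ : ∀ r, Measurable fun ω => Z ω r)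
    (hind : iIndepFun (fun r ω => Z ω r) μ) (hmean : ∀ r i, ∫ ω, Z ω r i ∂μ = 0)
    (hint : ∀ r k, Integrable (fun ω => Z ω r k) μ)
    {i j : Fin n} (hij : i ≠ j) (a b : Fin d → ℝ) :
    ∫ ω, (Z ω i ⬝ᵥ a) * (Z ω j ⬝ᵥ b) ∂μ = 0 := by
  have hm := measurable_row_dotProduct hZ
  have hdot : ∀ c : Fin d → ℝ, Measurable fun y : Fin d → ℝ => y ⬝ᵥ c := fun c => by
    simp only [dotProduct]; fun_prop
  have h := ((hind.indepFun hij).comp (hdot a) (hdot b)).integral_mul_eq_mul_integral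
    (hm i a).aestronglyMeasurable (hm j b).aestronglyMeasurable
  have h0 : ∫ ω, Z ω i ⬝ᵥ a ∂μ = 0 := by
    simp only [dotProduct]
    rw [integral_finsetSum _ fun k _ => (hint i k).mul_const _]
    simp [integral_mul_const, hmean]
  simp only [Pi.mul_apply, Function.comp_apply] at h
  rw [h, h0, zero_mul]

/-- With high probability, a random matrix with independent rows is bounded below. -/
lemma exists_event_lower_isometry [IsProbabilityMeasure μ]
    (hZ : ∀ r, Measurable fun ω => Z ω r) (hind : iIndepFun (fun r ω => Z ω r) μ)
    (hτ : 0 < τ)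
    (hexp : ∀ r (v : EuclideanSpace ℝ (Fin d)), ‖v‖ = 1 →
      Integrable (fun ω => Real.exp (τ * (Z ω r ⬝ᵥ v.ofLp) ^ 2)) μ ∧
        ∫ ω, Real.exp (τ * (Z ω r ⬝ᵥ v.ofLp) ^ 2) ∂μ ≤ 2)
    {c₁ : ℝ} (hc₁ : 0 < c₁)
    (hlow : ∀ r (v : EuclideanSpace ℝ (Fin d)), ‖v‖ = 1 →
      c₁ ≤ ∫ ω, (Z ω r ⬝ᵥ v.ofLp) ^ 2 ∂μ)
    {p : ℝ} (hdp : d ≤ p)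
    (hn : 80 / (min (τ / 2) (c₁ * τ ^ 2 / 256) * c₁) * p ≤ n) :
    ∃ G : Set Ω, MeasurableSet G ∧ μ.real Gᶜ ≤ 2 * Real.exp (-p) ∧
      ∀ ω ∈ G, ∀ a : EuclideanSpace ℝ (Fin d),
        c₁ * n / 2 * ‖a‖ ^ 2 ≤ ∑ i, (Z ω i ⬝ᵥ a.ofLp) ^ 2 := by
  -- `η` is the Bernstein parameter, with `s = c₁ n / 8`, so that the deviation `4 s` is half of the
  -- lower bound `c₁ n` on the mean. Half of `η s` pays for the variance term and, by `hn`, the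
  -- other half for `5 p`.
  set η := min (τ / 2) (c₁ * τ ^ 2 / 256) with hη
  have hη0 : 0 < η := lt_min (by positivity) (by positivity)
  have hη1 : 16 / τ ^ 2 * η ≤ c₁ / 16 := by
    calc 16 / τ ^ 2 * η ≤ 16 / τ ^ 2 * (c₁ * τ ^ 2 / 256) := by gcongr; exact min_le_right _ _
      _ = c₁ / 16 := by field_simp; norm_num
  have hst : 5 * p + 16 / τ ^ 2 * η ^ 2 * (Finset.univ : Finset (Fin n)).card
      ≤ η * (c₁ * n / 8) := by
    rw [Finset.card_univ, Fintype.card_fin]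
    rw [div_mul_eq_mul_div, div_le_iff₀ (by positivity)] at hn
    have h1 : 16 / τ ^ 2 * η ^ 2 * n ≤ c₁ / 16 * (η * n) := by
      calc 16 / τ ^ 2 * η ^ 2 * n = 16 / τ ^ 2 * η * (η * n) := by ring
        _ ≤ _ := by gcongr
    linarith
  obtain ⟨G, hGm, hGp, hG⟩ := exists_event_bilin_concentration hZ hind hτ hexp Finset.univ id
    (fun i _ j _ h => ⟨h, h⟩) hdp (by positivity) hη0.le (min_le_left _ _) hst
  refine ⟨G, hGm, hGp, fun ω hω a => ?_⟩
  have h := (abs_le.1 (hG ω hω a a)).1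
  simp only [id, ← sq] at h
  have hE : c₁ * ‖a‖ ^ 2 * n ≤ ∑ i, ∫ ω', (Z ω' i ⬝ᵥ a.ofLp) ^ 2 ∂μ := by
    have : ∀ i ∈ (Finset.univ : Finset (Fin n)),
        c₁ * ‖a‖ ^ 2 ≤ ∫ ω', (Z ω' i ⬝ᵥ a.ofLp) ^ 2 ∂μ := by
      intro i _
      by_cases ha : a = 0
      · simp [ha]
      obtain ⟨u, hu, hau⟩ := exists_unit_smul ha
      have e : ∀ ω', (Z ω' i ⬝ᵥ a.ofLp) ^ 2 = ‖a‖ ^ 2 * (Z ω' i ⬝ᵥ u.ofLp) ^ 2 := fun ω' => by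
        rw [congrArg WithLp.ofLp hau, WithLp.ofLp_smul, dotProduct_smul, smul_eq_mul, mul_pow]
      simp_rw [e]
      rw [integral_const_mul, mul_comm]
      gcongr
      exact hlow i u hu
    have h2 := Finset.card_nsmul_le_sum _ _ _ this
    rw [Finset.card_univ, Fintype.card_fin, nsmul_eq_mul] at h2
    linarith
  linarith

/-- With high probability, the bilinear form `(a, b) ↦ ⟨Z a, P_π Z b⟩` is of order
`√((p + k) n)`, where `k` is the number of fixed points of `π`. -/
lemma exists_event_permuted_bilin_le [IsProbabilityMeasure μ]
    (hZ : ∀ r, Measurable fun ω => Z ω r) (hind : iIndepFun (fun r ω => Z ω r) μ)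
    (hmean : ∀ r i, ∫ ω, Z ω r i ∂μ = 0)
    (hτ : 0 < τ)
    (hexp : ∀ r (v : EuclideanSpace ℝ (Fin d)), ‖v‖ = 1 →
      Integrable (fun ω => Real.exp (τ * (Z ω r ⬝ᵥ v.ofLp) ^ 2)) μ ∧
        ∫ ω, Real.exp (τ * (Z ω r ⬝ᵥ v.ofLp) ^ 2) ∂μ ≤ 2)
    (π : Equiv.Perm (Fin n)) {p : ℝ} (hdp : d ≤ p)
    (hn : p + (Finset.univ.filter fun i => π i = i).card ≤ n) (hn0 : 0 < n) :
    ∃ G : Set Ω, MeasurableSet G ∧ μ.real Gᶜ ≤ 8 * Real.exp (-p) ∧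
      ∀ ω ∈ G, ∀ a b : EuclideanSpace ℝ (Fin d),
        |∑ i, (Z ω i ⬝ᵥ a.ofLp) * (Z ω (π i) ⬝ᵥ b.ofLp)|
          ≤ 256 / τ * √((p + (Finset.univ.filter fun i => π i = i).card) * n) * ‖a‖ * ‖b‖ := by
  set F := Finset.univ.filter fun i => π i = i with hF
  have hp0 : 0 ≤ p := (Nat.cast_nonneg d).trans hdp
  have hnR : (0 : ℝ) < n := by exact_mod_cast hn0
  have hpn : p ≤ n := by linarith [(Nat.cast_nonneg F.card : (0 : ℝ) ≤ F.card)]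
  have hprod := integrable_and_abs_integral_row_mul_row hZ hτ hexp
  have hint : ∀ r k, Integrable (fun ω => Z ω r k) μ := by
    intro r k
    have hm : Measurable fun ω => Z ω r k := (measurable_pi_apply k).comp (hZ r)
    have h := (hprod r r (EuclideanSpace.single k 1) (EuclideanSpace.single k 1)).1
    simp only [PiLp.ofLp_single, dotProduct_single, mul_one, ← sq] at h
    exact ((memLp_two_iff_integrable_sq hm.aestronglyMeasurable).2 h).integrable one_le_two
  -- the fixed points
  have hst : 5 * p + 16 / τ ^ 2 * (τ / 2) ^ 2 * F.card
      ≤ τ / 2 * ((10 * p + 8 * F.card) / τ) := by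
    apply le_of_eq; field_simp; ring
  obtain ⟨G, hGm, hGp, hG⟩ := exists_event_bilin_concentration hZ hind hτ hexp F id
    (fun i _ j _ h => ⟨h, h⟩) hdp (by positivity) (by positivity) le_rfl hst
  have hGF : ∀ ω ∈ G, ∀ a b : EuclideanSpace ℝ (Fin d),
      |∑ i ∈ F, (Z ω i ⬝ᵥ a.ofLp) * (Z ω (π i) ⬝ᵥ b.ofLp)|
        ≤ 40 / τ * √((p + F.card) * n) * ‖a‖ * ‖b‖ := by
    intro ω hω a b
    have h := hG ω hω a b
    have e : ∑ i ∈ F, (Z ω i ⬝ᵥ a.ofLp) * (Z ω (π i) ⬝ᵥ b.ofLp)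
        = ∑ i ∈ F, (Z ω i ⬝ᵥ a.ofLp) * (Z ω (id i) ⬝ᵥ b.ofLp) :=
      Finset.sum_congr rfl fun i hi => by rw [(Finset.mem_filter.1 hi).2, id]
    -- At a fixed point both factors use the same row, so the mean need not vanish; this contributes
    -- an error linear in the number of fixed points.
    have hE : |∑ i ∈ F, ∫ ω', (Z ω' i ⬝ᵥ a.ofLp) * (Z ω' (id i) ⬝ᵥ b.ofLp) ∂μ|
        ≤ F.card * (2 / τ * ‖a‖ * ‖b‖) := by
      refine (Finset.abs_sum_le_sum_abs _ _).trans ?_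
      rw [← nsmul_eq_mul]
      exact Finset.sum_le_card_nsmul _ _ _ fun i _ => (hprod i i a b).2
    -- The fixed-point error is linear in `p + k`; since `p + k ≤ n`, it is also below the geometric
    -- mean with `n`.
    have hsq : p + F.card ≤ √((p + F.card) * n) := by
      apply Real.le_sqrt_of_sq_le
      rw [sq]; gcongr
    rw [e]
    calc _ ≤ 4 * ((10 * p + 8 * F.card) / τ) * ‖a‖ * ‖b‖ + F.card * (2 / τ * ‖a‖ * ‖b‖) := by
          refine le_trans ?_ (add_le_add h hE)
          rw [← sub_le_iff_le_add]
          exact abs_sub_abs_le_abs_sub _ _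
      _ = (40 * p + 34 * F.card) / τ * ‖a‖ * ‖b‖ := by ring
      _ ≤ (40 * (p + F.card)) / τ * ‖a‖ * ‖b‖ := by
          gcongr
          linarith [(Nat.cast_nonneg F.card : (0 : ℝ) ≤ F.card)]
      _ = 40 / τ * (p + F.card) * ‖a‖ * ‖b‖ := by ring
      _ ≤ _ := by gcongr
  -- the other points, colour by colour
  obtain ⟨col, hcol⟩ := exists_three_coloring π
  let S : Fin 3 → Finset (Fin n) := fun c => Finset.univ.filter fun i => π i ≠ i ∧ col i = c
  have hS : ∀ c, ∀ i ∈ S c, ∀ j ∈ S c, i ≠ j → i ≠ π j ∧ π i ≠ π j := by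
    intro c i hi j hj hij
    obtain ⟨-, -, hi2⟩ := Finset.mem_filter.1 hi
    obtain ⟨-, hj1, hj2⟩ := Finset.mem_filter.1 hj
    refine ⟨fun h => hcol j hj1 ?_, fun h => hij (π.injective h)⟩
    rw [← h, hi2, hj2]
  -- Here `t` is of order `√(p / n)`, the sub-Gaussian regime of Bernstein: the variance term is at
  -- most `4 p`, and `t s = 9 p`.
  have hst' : ∀ c, 5 * p + 16 / τ ^ 2 * (τ / 2 * √(p / n)) ^ 2 * (S c).card
      ≤ τ / 2 * √(p / n) * (18 / τ * √(p * n)) := by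
    intro c
    have h1 : √(p / n) * √(p * n) = p := by
      rw [← Real.sqrt_mul (by positivity), show p / n * (p * n) = p * p by field_simp,
        Real.sqrt_mul_self hp0]
    have h2 : ((S c).card : ℝ) ≤ n := by
      exact_mod_cast (Finset.card_le_univ _).trans (by simp)
    have h3 : 16 / τ ^ 2 * (τ / 2 * √(p / n)) ^ 2 * (S c).card ≤ 4 * p := by
      rw [mul_pow, Real.sq_sqrt (by positivity)]
      calc 16 / τ ^ 2 * ((τ / 2) ^ 2 * (p / n)) * (S c).card
          ≤ 16 / τ ^ 2 * ((τ / 2) ^ 2 * (p / n)) * n := by gcongr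
        _ = 4 * p := by field_simp; ring
    have h4 : τ / 2 * √(p / n) * (18 / τ * √(p * n)) = 9 * p := by
      rw [show τ / 2 * √(p / n) * (18 / τ * √(p * n))
        = 9 * (τ / τ) * (√(p / n) * √(p * n)) by ring, h1, div_self hτ.ne', mul_one]
    linarith
  have hsq1 : √(p / n) ≤ 1 := by
    rw [Real.sqrt_le_one, div_le_one hnR]; exact hpn
  choose H hHm hHp hH using fun c => exists_event_bilin_concentration hZ hind hτ hexp (S c) π
    (hS c) hdp (by positivity) (by positivity) (by nlinarith) (hst' c)
  refine ⟨G ∩ ⋂ c, H c, hGm.inter (MeasurableSet.iInter hHm), ?_, fun ω hω a b => ?_⟩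
  · rw [Set.compl_inter, Set.compl_iInter]
    refine (measureReal_union_le _ _).trans ?_
    have h3 : μ.real (⋃ c, (H c)ᶜ) ≤ 3 * (2 * Real.exp (-p)) := by
      refine (measureReal_iUnion_fintype_le _).trans ?_
      refine (Finset.sum_le_sum fun c _ => hHp c).trans (le_of_eq ?_)
      simp
    linarith
  · have hHc : ∀ c, |∑ i ∈ S c, (Z ω i ⬝ᵥ a.ofLp) * (Z ω (π i) ⬝ᵥ b.ofLp)|
        ≤ 72 / τ * √((p + F.card) * n) * ‖a‖ * ‖b‖ := by
      intro c
      have h := hH c ω (Set.mem_iInter.1 hω.2 c) a b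
      rw [Finset.sum_eq_zero (f := fun i =>
        ∫ ω', (Z ω' i ⬝ᵥ a.ofLp) * (Z ω' (π i) ⬝ᵥ b.ofLp) ∂μ) fun i hi =>
          integral_row_mul_row_eq_zero hZ hind hmean hint (Finset.mem_filter.1 hi).2.1.symm _ _,
        sub_zero] at h
      calc _ ≤ 4 * (18 / τ * √(p * n)) * ‖a‖ * ‖b‖ := h
        _ = 72 / τ * √(p * n) * ‖a‖ * ‖b‖ := by ring
        _ ≤ _ := by
          gcongr
          linarith [(Nat.cast_nonneg F.card : (0 : ℝ) ≤ F.card)]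
    have hsplit : ∀ f : Fin n → ℝ, ∑ i, f i = ∑ i ∈ F, f i + ∑ c, ∑ i ∈ S c, f i := by
      intro f
      rw [hF, ← Finset.sum_filter_add_sum_filter_not Finset.univ (fun i => π i = i) f]
      congr 1
      rw [← Finset.sum_fiberwise _ col]
      simp only [Finset.filter_filter, S, ne_eq]
    rw [hsplit, Fin.sum_univ_three]
    have h0 := hGF ω hω.1 a b
    have := abs_add_three (∑ i ∈ S 0, (Z ω i ⬝ᵥ a.ofLp) * (Z ω (π i) ⬝ᵥ b.ofLp))
      (∑ i ∈ S 1, (Z ω i ⬝ᵥ a.ofLp) * (Z ω (π i) ⬝ᵥ b.ofLp))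
      (∑ i ∈ S 2, (Z ω i ⬝ᵥ a.ofLp) * (Z ω (π i) ⬝ᵥ b.ofLp))
    refine (abs_add_le _ _).trans ?_
    -- The constant is `40` from the fixed points plus `72` from each of the three colours.
    have e : 256 / τ * √((p + F.card) * n) * ‖a‖ * ‖b‖
        = 40 / τ * √((p + F.card) * n) * ‖a‖ * ‖b‖
          + 3 * (72 / τ * √((p + F.card) * n) * ‖a‖ * ‖b‖) := by ring
    linarith [hHc 0, hHc 1, hHc 2]

end

/-! ### From column spaces to quadratic and bilinear forms. -/

section ColumnSpace

variable {n : ℕ} {ι : Type*}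

lemma exists_of_mem_colSpace [Fintype ι] {M : Matrix (Fin n) ι ℝ}
    {u : EuclideanSpace ℝ (Fin n)} (hu : u ∈ colSpace M) :
    ∃ a : EuclideanSpace ℝ ι, ∀ i, u i = M i ⬝ᵥ a.ofLp := by
  obtain ⟨c, hc⟩ := (Submodule.mem_span_range_iff_exists_fun ℝ).1 hu
  refine ⟨WithLp.toLp 2 c, fun i => ?_⟩
  rw [← hc]
  simp [dotProduct, mul_comm]

lemma permRows_apply (π : Equiv.Perm (Fin n)) (M : Matrix (Fin n) ι ℝ) (i : Fin n) :
    permRows π M i = M (π i) := by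
  rw [permRows, PEquiv.toMatrix_toPEquiv_mul]
  rfl

lemma colSpace_joint (π : Equiv.Perm (Fin n)) (M : Matrix (Fin n) ι ℝ) :
    colSpace (joint π M) = colSpace M ⊔ colSpace (permRows π M) := by
  rw [colSpace, colSpace, colSpace, ← Submodule.span_union, ← Set.Sum.elim_range]
  congr 2
  funext j
  rcases j with j | j <;> rfl

/-- A bound on the cosine of the angle between the column spaces of `M` and `P_π M` bounds the
projection onto the column space of `[M, P_π M]`. -/
lemma norm_sq_hat_joint_le [Fintype ι] {M : Matrix (Fin n) ι ℝ} {π : Equiv.Perm (Fin n)} {ε : ℝ}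
    (hε0 : 0 ≤ ε) (hε1 : ε < 1)
    (h : ∀ a b : EuclideanSpace ℝ ι, (∑ i, (M i ⬝ᵥ a.ofLp) * (M (π i) ⬝ᵥ b.ofLp)) ^ 2
      ≤ ε * (∑ i, (M i ⬝ᵥ a.ofLp) ^ 2) * ∑ i, (M i ⬝ᵥ b.ofLp) ^ 2)
    (X : EuclideanSpace ℝ (Fin n)) :
    ‖hat (joint π M) X‖ ^ 2
      ≤ ‖hat M X‖ ^ 2 + 1 / (1 - ε) * ‖hat (permRows π M) (X - hat M X)‖ ^ 2 := by
  simp only [hat, colSpace_joint]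
  rw [norm_sq_starProjection_eq_add_of_le
    (le_sup_left : colSpace M ≤ colSpace M ⊔ colSpace (permRows π M))]
  gcongr
  refine norm_sq_starProjection_sup_le hε0 hε1 (fun u hu v hv => ?_)
    (Submodule.sub_starProjection_mem_orthogonal X)
  obtain ⟨a, ha⟩ := exists_of_mem_colSpace hu
  obtain ⟨b, hb⟩ := exists_of_mem_colSpace hv
  have e1 : inner ℝ u v = ∑ i, (M i ⬝ᵥ a.ofLp) * (M (π i) ⬝ᵥ b.ofLp) := by
    simp [PiLp.inner_apply, ha, hb, permRows_apply, mul_comm]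
  have e2 : ‖u‖ ^ 2 = ∑ i, (M i ⬝ᵥ a.ofLp) ^ 2 := by
    simp [EuclideanSpace.real_norm_sq_eq, ha]
  have e3 : ‖v‖ ^ 2 = ∑ i, (M i ⬝ᵥ b.ofLp) ^ 2 := by
    simp only [EuclideanSpace.real_norm_sq_eq, hb, permRows_apply]
    exact Equiv.sum_comp π fun i => (M i ⬝ᵥ b.ofLp) ^ 2
  rw [e1, e2, e3]
  exact h a b

end ColumnSpace

/-! ### Assembly of the two bounds. -/

theorem mainTheorem6 :
    (∀ (n p : ℕ) (Z : Matrix (Fin n) (Fin (p - 1)) ℝ) (π : Equiv.Perm (Fin n))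
      (X : EuclideanSpace ℝ (Fin n)),
      ‖hat Z X‖ ^ 2 + ‖hat (permRows π Z) (X - hat Z X)‖ ^ 2
        ≤ inner ℝ X (hat (joint π Z) X)) ∧
    (∀ c₁ c₂ : ℝ, 0 < c₁ → 0 < c₂ → ∃ C : ℝ, 0 < C ∧
      ∀ (n p : ℕ), 1 ≤ p →
      ∀ (Ω : Type*) (_ : MeasurableSpace Ω) (μ : Measure Ω) (_ : IsProbabilityMeasure μ)
        (Z : Ω → Matrix (Fin n) (Fin (p - 1)) ℝ),
        (∀ r, Measurable fun ω => Z ω r) →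
        iIndepFun (fun r ω => Z ω r) μ →
        (∀ r i, ∫ ω, Z ω r i ∂μ = 0) →
        (∀ (r : Fin n) (v : Fin (p - 1) → ℝ), ∑ i, v i ^ 2 = 1 →
          c₁ ≤ ∫ ω, (Z ω r ⬝ᵥ v) ^ 2 ∂μ ∧
          ∀ t : ℝ, Integrable (fun ω => Real.exp (t * (Z ω r ⬝ᵥ v))) μ ∧
            ∫ ω, Real.exp (t * (Z ω r ⬝ᵥ v)) ∂μ ≤ Real.exp (c₂ * t ^ 2)) →
        ∀ π : Equiv.Perm (Fin n), C * (p + (π.permMatrix ℝ).trace) < n →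
          ∃ E : Set Ω, MeasurableSet E ∧ 1 - 40 * Real.exp (-(p : ℝ)) ≤ μ.real E ∧
            ∀ ω ∈ E, ∀ X : EuclideanSpace ℝ (Fin n),
              ‖hat (joint π (Z ω)) X‖ ^ 2 ≤ ‖hat (Z ω) X‖ ^ 2 +
                1 / (1 - C * (p + (π.permMatrix ℝ).trace) / n) *
                  ‖hat (permRows π (Z ω)) (X - hat (Z ω) X)‖ ^ 2) := by
  refine ⟨fun n p Z π X => ?_, fun c₁ c₂ hc₁ hc₂ => ?_⟩
  · simp only [hat, colSpace_joint]
    rw [inner_starProjection_self_eq_norm_sq, norm_sq_starProjection_eq_add_of_le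
      (le_sup_left : colSpace Z ≤ colSpace Z ⊔ colSpace (permRows π Z))]
    gcongr
    exact norm_starProjection_le_of_le le_sup_right _
  · set τ : ℝ := 1 / (8 * c₂) with hτdef
    have hτ : 0 < τ := by positivity
    set B : ℝ := 80 / (min (τ / 2) (c₁ * τ ^ 2 / 256) * c₁) with hB
    have hB0 : 0 < B :=
      div_pos (by norm_num) (mul_pos (lt_min (by positivity) (by positivity)) hc₁)
    -- The summand `1` ensures `p + k ≤ n`, `B` the sample size for the lower isometry, and the
    -- square bounds the cosine: `256 / τ` from the numerator over `c₁ / 2` from the denominator.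
    refine ⟨1 + B + (512 / (τ * c₁)) ^ 2, by positivity, ?_⟩
    set C : ℝ := 1 + B + (512 / (τ * c₁)) ^ 2 with hC
    intro n p hp Ω _ μ _ Z hZ hind hmean hrow π hCn
    have hunit : ∀ v : EuclideanSpace ℝ (Fin (p - 1)), ‖v‖ = 1 → ∑ i, v.ofLp i ^ 2 = 1 := by
      intro v hv
      rw [← EuclideanSpace.real_norm_sq_eq, hv, one_pow]
    have hexp : ∀ r (v : EuclideanSpace ℝ (Fin (p - 1))), ‖v‖ = 1 →
        Integrable (fun ω => Real.exp (τ * (Z ω r ⬝ᵥ v.ofLp) ^ 2)) μ ∧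
          ∫ ω, Real.exp (τ * (Z ω r ⬝ᵥ v.ofLp) ^ 2) ∂μ ≤ 2 := by
      intro r v hv
      have h := exp_sq_moment_of_subgaussian (measurable_row_dotProduct hZ r v.ofLp) hc₂
        (hrow r v.ofLp (hunit v hv)).2
      simpa only [hτdef, one_div, div_eq_inv_mul, mul_one] using h
    have htr : (π.permMatrix ℝ).trace = (Finset.univ.filter fun i => π i = i).card := by
      rw [Matrix.trace_permutation, Set.ncard_eq_toFinset_card']
      congr 2
      ext i
      simp [Function.mem_fixedPoints, Function.IsFixedPt]
    rw [htr] at hCn ⊢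
    set k : ℝ := ((Finset.univ.filter fun i => π i = i).card : ℝ) with hk
    have hk0 : 0 ≤ k := Nat.cast_nonneg _
    have hp0 : (0 : ℝ) < p := by exact_mod_cast hp
    have hn0 : (0 : ℝ) < n := lt_of_le_of_lt (by positivity) hCn
    have hpk : (p : ℝ) + k ≤ n := by
      refine le_trans ?_ hCn.le
      exact le_mul_of_one_le_left (by positivity) 
        (by rw [hC]; nlinarith [sq_nonneg (512 / (τ * c₁))])
    have hBp : B * p ≤ n := by
      refine le_trans ?_ hCn.le
      gcongr
      · rw [hC]; nlinarith [sq_nonneg (512 / (τ * c₁))]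
      · linarith
    have hdp : ((p - 1 : ℕ) : ℝ) ≤ p := by exact_mod_cast Nat.sub_le p 1
    obtain ⟨G, hGm, hGp, hG⟩ := exists_event_lower_isometry hZ hind hτ hexp hc₁
      (fun r v hv => (hrow r v.ofLp (hunit v hv)).1) hdp hBp
    obtain ⟨H, hHm, hHp, hH⟩ := exists_event_permuted_bilin_le hZ hind hmean hτ hexp π hdp hpk
      (by exact_mod_cast hn0)
    refine ⟨G ∩ H, hGm.inter hHm, ?_, fun ω hω X => ?_⟩
    · have h1 := measureReal_union_le (μ := μ) Gᶜ Hᶜ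
      rw [← Set.compl_inter, probReal_compl_eq_one_sub (hGm.inter hHm)] at h1
      -- The failure probabilities add up to `(2 + 8) exp (-p)`, well within the allowed `40 exp
      -- (-p)`.
      linarith [Real.exp_pos (-(p : ℝ))]
    · refine norm_sq_hat_joint_le (by positivity) ((div_lt_one hn0).2 hCn) (fun a b => ?_) X
      have ha := hG ω hω.1 a
      have hb := hG ω hω.1 b
      have hab := hH ω hω.2 a b
      calc (∑ i, (Z ω i ⬝ᵥ a.ofLp) * (Z ω (π i) ⬝ᵥ b.ofLp)) ^ 2
          ≤ (256 / τ * √((p + k) * n) * ‖a‖ * ‖b‖) ^ 2 := by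
            rw [← sq_abs]
            exact pow_le_pow_left₀ (abs_nonneg _) hab 2
        _ = (512 / (τ * c₁)) ^ 2 * (p + k) / n * (c₁ * n / 2 * ‖a‖ ^ 2)
              * (c₁ * n / 2 * ‖b‖ ^ 2) := by
            simp only [mul_pow]
            rw [Real.sq_sqrt (by positivity)]
            field_simp
            ring
        _ ≤ C * (p + k) / n * (∑ i, (Z ω i ⬝ᵥ a.ofLp) ^ 2) * ∑ i, (Z ω i ⬝ᵥ b.ofLp) ^ 2 := by
            have : (512 / (τ * c₁)) ^ 2 ≤ C := by rw [hC]; linarith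
            gcongr
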